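/- A quantum switch serves $R$ entanglement requests among $N$ users in slots $t=1,2,\dots$. Request $i$ has a nonempty set of users $\mathcal G(i)$. If request $i$ is scheduled in a slot ($u_i(t)=1$), each user $j\in\mathcal G(i)$ independently succeeds with probability $p_j\in(0,1]$; if all of them succeed, an end-to-end operation succeeds with probability $q_{|\mathcal G(i)|}\in(0,1]$, and then the request is served ($d_i(t)=1$); otherwise $d_i(t)=0$. Outcomes are independent across slots and requests. Put $v(i)=\prod_{j\in\mathcal G(i)}p_j$, so that a scheduled request $i$ of cardinality $\lambda=|\mathcal G(i)|$ is served with probability $q_\lambda v(i)$. The age of request $i$ is $h_i(t)=t-\sup\{t'\in\{1,\dots,t-1\}: d_i(t')=1\}$ with $\sup\emptyset=0$. For $\tau\ge 0$ let $$g_i(\tau)=\inf_{\pi}\limsup_{T\to\infty}\frac1T\sum_{t=1}^{T}\mathbb E\big[h_i^\pi(t)+\tau|\mathcal G(i)|u_i^\pi(t)\big],$$ the infimum being over all causal (history-dependent, randomized) scheduling policies, without a memory constraint. Let $\mathcal P_i(\tau)$ be the set of ages $s\in\{1,2,\dots\}$ at which the passive action $u_i=0$ is optimal, i.e. attains the minimum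 in the average-cost optimality equation $$g_i(\tau)+V(s)=\min\big\{\,s+V(s+1),\ \ s+\tau\lambda+q_\lambda v(i)V(1)+(1-q_\lambda v(i))V(s+1)\big\},\qquad s\ge 1,$$ for a solution $V$ that is bounded below. The Whittle index of request $i$ at age $s$ is $W_i(s)=\inf\{\tau\ge 0: s\in\mathcal P_i(\tau)\}$. Theorem. For every request $i$ with cardinality $\lambda=|\mathcal G(i)|$ and every age $s\in\{1,2,\dots\}$, $$W_i(s)=\frac{s\,\big(q_\lambda v(i)\,s-q_\lambda v(i)+2\big)}{2\lambda}.$$ -/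

import Mathlib

open Filter
open scoped ENNReal

noncomputable section

namespace QSwitch

/-- The law of a Boolean that is `true` with probability `x`. -/
def coin (x : ℝ) (hx : x ∈ Set.Ioc (0 : ℝ) 1) : PMF Bool :=
  PMF.ofFintype (fun b => if b then ENNReal.ofReal x else ENNReal.ofReal (1 - x)) (by
    rw [Fintype.sum_bool]
    simp only [if_true, Bool.false_eq_true, if_false]
    rw [← ENNReal.ofReal_add hx.1.le (by linarith [hx.2])]
    norm_num)

/-- The joint law of finitely many independent random variables with laws `μ k`. -/
def indep {ι : Type} [Fintype ι] [DecidableEq ι] {α : Type} [Fintype α]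
    (μ : ι → PMF α) : PMF (ι → α) :=
  PMF.ofFintype (fun ω => ∏ k, μ k (ω k)) (by
    have h := Finset.prod_univ_sum (fun _ : ι => (Finset.univ : Finset α)) (fun k a => μ k a)
    rw [Fintype.piFinset_univ] at h
    rw [← h]
    refine Finset.prod_eq_one fun k _ => ?_
    have := (μ k).tsum_coe
    rwa [tsum_fintype] at this)

/-- A quantum switch with `N` users and `R` multipartite entanglement requests. -/
structure Network (N R : ℕ) where
  /-- `p j` is the probability that user `j` establishes a link-level entanglement. -/
  p : Fin N → ℝ
  /-- `G i` is the set of users of request `i`. -/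
  G : Fin R → Finset (Fin N)
  /-- `q l` is the success probability of an end-to-end operation among `l` users. -/
  q : ℕ → ℝ
  p_mem : ∀ j, p j ∈ Set.Ioc (0 : ℝ) 1
  G_nonempty : ∀ i, (G i).Nonempty
  q_mem : ∀ i, q (G i).card ∈ Set.Ioc (0 : ℝ) 1

/-- What happens to one request in one slot: which of its users establish a link-level
entanglement for it, and whether its end-to-end entanglement is established. -/
abbrev Attempt (N : ℕ) : Type := (Fin N → Bool) × Bool

/-- The record of one slot: the set of scheduled requests and the result for each request. -/
abbrev Slot (N R : ℕ) : Type := Finset (Fin R) × (Fin R → Attempt N)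

/-- A (history-dependent, randomized) causal scheduling policy. At the beginning of slot `n + 1`
it sees the records of the `n` previous slots and draws the set of requests to schedule. -/
abbrev Policy (N R : ℕ) : Type := (n : ℕ) → (Fin n → Slot N R) → PMF (Finset (Fin R))

/-- The age of request `i` at the beginning of slot `t = n + 1`, given the previous `n` slots:
`t` minus the last slot in which request `i` was served (`0` if there is none). Entry `k` of the
history is slot `k + 1`. -/
def age {N R n : ℕ} (i : Fin R) (H : Fin n → Slot N R) : ℕ :=
  (n + 1) - (Finset.univ.filter fun k => ((H k).2 i).2 = true).sup fun k => (k : ℕ) + 1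

namespace Network

variable {N R : ℕ} (S : Network N R)

/-- `v i`: the probability that all users of request `i` succeed. -/
def v (i : Fin R) : ℝ := ∏ j ∈ S.G i, S.p j

/-- The law of the result of an attempt for request `i` in a slot in which it is scheduled: the
users of `G i` succeed independently; if all of them do, the end-to-end operation is tried. -/
def attemptLaw (i : Fin R) : PMF (Attempt N) :=
  (indep fun j => if j ∈ S.G i then coin (S.p j) (S.p_mem j) else PMF.pure false).bind fun b =>
    (if ∀ j ∈ S.G i, b j = true then coin (S.q (S.G i).card) (S.q_mem i)
      else PMF.pure false).map fun d => (b, d)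

/-- The law of the results of one slot in which the set `U` of requests is scheduled. -/
def slotLaw (U : Finset (Fin R)) : PMF (Fin R → Attempt N) :=
  indep fun i => if i ∈ U then S.attemptLaw i else PMF.pure (fun _ => false, false)

/-- The law of the records of the first `n` slots under the policy `π`. -/
def historyLaw (π : Policy N R) : (n : ℕ) → PMF (Fin n → Slot N R)
  | 0 => PMF.pure fun k => k.elim0
  | n + 1 => (historyLaw π n).bind fun H => (π n H).bind fun U =>
      (S.slotLaw U).map fun o => Fin.snoc (α := fun _ => Slot N R) H (U, o)

/-- The expectation of `h i t + τ * |G i| * u i t` in slot `t = n + 1` under the policy `π`. -/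
def expectedCost (π : Policy N R) (i : Fin R) (τ : ℝ) (n : ℕ) : ℝ :=
  ∑ H : Fin n → Slot N R, ∑ U : Finset (Fin R),
    (S.historyLaw π n H).toReal * (π n H U).toReal *
      ((age i H : ℝ) + τ * ((S.G i).card : ℝ) * (if i ∈ U then 1 else 0))

/-- The long-run average cost of request `i` under the policy `π`, in the extended reals. -/
def averageCost (π : Policy N R) (i : Fin R) (τ : ℝ) : EReal :=
  limsup (fun T : ℕ =>
    (((1 / (T : ℝ)) * ∑ n ∈ Finset.range T, S.expectedCost π i τ n : ℝ) : EReal)) atTop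

/-- The optimal value of the sub-problem of request `i` with multiplier `τ`. -/
def optimalCost (i : Fin R) (τ : ℝ) : EReal :=
  ⨅ π : Policy N R, S.averageCost π i τ

/-- The immediate cost plus the expected value of `V` at the next age, for request `i` at age `s`
under the active action (`a = true`) or the passive action (`a = false`). The age moves
from `s` to `1` if request `i` is served, and to `s + 1` otherwise. -/
def actionValue (i : Fin R) (τ : ℝ) (V : ℕ → ℝ) (s : ℕ) (a : Bool) : ℝ :=
  if a then
    (s : ℝ) + τ * ((S.G i).card : ℝ) + (S.q (S.G i).card * S.v i * V 1
      + (1 - S.q (S.G i).card * S.v i) * V (s + 1))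
  else (s : ℝ) + V (s + 1)

/-- `V` is a relative value function of the average-cost problem of request `i`: it is bounded
below on the ages `s ≥ 1` and, with the optimal average cost `g`, solves the average-cost
optimality equation `g + V s = min_a actionValue s a`. The lower bound excludes
the spurious solutions in which paying for service is postponed for ever. -/
def IsRelativeValue (i : Fin R) (τ : ℝ) (V : ℕ → ℝ) : Prop :=
  (∃ B : ℝ, ∀ s, 1 ≤ s → B ≤ V s) ∧
  ∃ g : ℝ, (g : EReal) = S.optimalCost i τ ∧
    ∀ s, 1 ≤ s →
      g + V s = min (S.actionValue i τ V s false) (S.actionValue i τ V s true)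

/-- The ages of request `i` in which the passive action is optimal for the multiplier `τ`, that
is, attains the minimum in the average-cost optimality equation. -/
def passiveSet (i : Fin R) (τ : ℝ) : Set ℕ :=
  {s | 1 ≤ s ∧ ∃ V : ℕ → ℝ, S.IsRelativeValue i τ V ∧
    S.actionValue i τ V s false ≤ S.actionValue i τ V s true}

/-- The Whittle index of request `i` at age `s`: the infimum, in the extended reals, of the
multipliers `τ ≥ 0` for which the passive action is optimal at `s`. -/
def whittleIndex (i : Fin R) (s : ℕ) : EReal :=
  sInf ((fun τ : ℝ => (τ : EReal)) '' {τ : ℝ | 0 ≤ τ ∧ s ∈ S.passiveSet i τ})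

end Network

end QSwitch

end

noncomputable section

namespace QSwitch

/-! Write `m = q_λ v(i)` and `c = τ λ`. The cost of a request sees only its own age, which resets to
1 with probability `m` on activation and otherwise grows by 1. The natural candidates are threshold
policies; renewal reward over the cycles between services gives the cost `thresholdCost`, and
solving the optimality equation gives relative values that are quadratic up to the threshold `n` and
linear beyond it. This solution satisfies the full equation when `c` lies between the critical costs
of `n - 1` and `n`, and `optimalCost_eq` then identifies the optimal cost over all policies.

If `c` is critical for `s`, threshold `s + 1` is optimal, so `s` is passive. If `c` is smaller, some
threshold `n ≤ s` is optimal and its solution is strictly active at `s`. Passivity quantifies over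
every solution bounded below, so this must be transferred to all of them: for `m < 1` by uniqueness
up to a constant (`relativeValue_unique`), for `m = 1`, where that argument fails, by the lower
bound (`lt_of_bddBelow`). The least admissible `τ` is thus `criticalCost m s / λ`. -/

/-- The expectation of `f` under a probability mass function on a finite type. -/
def expect {α : Type} [Fintype α] (P : PMF α) (f : α → ℝ) : ℝ := ∑ a, (P a).toReal * f a

/-! ### Expectations under finite laws -/

section Expect

variable {α β : Type} [Fintype α] [Fintype β]

lemma sum_toReal (P : PMF α) : ∑ a, (P a).toReal = 1 := by
  rw [← ENNReal.toReal_sum fun a _ => P.apply_ne_top a, ← tsum_fintype (L := .unconditional α),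
    P.tsum_coe, ENNReal.toReal_one]

lemma expect_const (P : PMF α) (c : ℝ) : expect P (fun _ => c) = c := by
  rw [expect, ← Finset.sum_mul, sum_toReal, one_mul]

lemma expect_add (P : PMF α) (f g : α → ℝ) :
    expect P (fun a => f a + g a) = expect P f + expect P g := by
  simp only [expect, mul_add, Finset.sum_add_distrib]

lemma expect_const_mul (P : PMF α) (c : ℝ) (f : α → ℝ) :
    expect P (fun a => c * f a) = c * expect P f := by
  simp only [expect, Finset.mul_sum]
  exact Finset.sum_congr rfl fun a _ => by ring

lemma expect_mono (P : PMF α) {f g : α → ℝ} (h : ∀ a, f a ≤ g a) : expect P f ≤ expect P g :=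
  Finset.sum_le_sum fun a _ => mul_le_mul_of_nonneg_left (h a) ENNReal.toReal_nonneg

lemma le_expect (P : PMF α) {c : ℝ} {f : α → ℝ} (h : ∀ a, c ≤ f a) : c ≤ expect P f :=
  (expect_const P c).ge.trans (expect_mono P h)

lemma expect_pure (a : α) (f : α → ℝ) : expect (PMF.pure a) f = f a := by
  classical
  rw [expect, Finset.sum_eq_single a]
  · simp
  · intro b _ hb
    simp [PMF.pure_apply, hb]
  · simp

lemma expect_bind (P : PMF α) (k : α → PMF β) (f : β → ℝ) :
    expect (P.bind k) f = expect P fun a => expect (k a) f := by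
  simp only [expect, PMF.bind_apply, tsum_fintype, Finset.mul_sum]
  rw [Finset.sum_comm]
  refine Finset.sum_congr rfl fun b _ => ?_
  rw [ENNReal.toReal_sum fun a _ => ENNReal.mul_ne_top (P.apply_ne_top a) ((k a).apply_ne_top b),
    Finset.sum_mul]
  exact Finset.sum_congr rfl fun a _ => by rw [ENNReal.toReal_mul, mul_assoc]

lemma expect_map (P : PMF α) (k : α → β) (f : β → ℝ) :
    expect (P.map k) f = expect P fun a => f (k a) := by
  rw [← PMF.bind_pure_comp, expect_bind]
  simp only [Function.comp_apply, expect_pure]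

lemma expect_coin (x : ℝ) (hx : x ∈ Set.Ioc (0 : ℝ) 1) (f : Bool → ℝ) :
    expect (coin x hx) f = x * f true + (1 - x) * f false := by
  simp [expect, coin, ENNReal.toReal_ofReal hx.1.le, ENNReal.toReal_ofReal (sub_nonneg.2 hx.2)]

lemma expect_indep_prod {ι : Type} [Fintype ι] [DecidableEq ι] (μ : ι → PMF α)
    (f : ι → α → ℝ) :
    expect (indep μ) (fun ω => ∏ k, f k (ω k)) = ∏ k, expect (μ k) (f k) := by
  simp only [expect, indep, PMF.ofFintype_apply, ENNReal.toReal_prod, ← Finset.prod_mul_distrib]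
  rw [Finset.prod_univ_sum, Fintype.piFinset_univ]

lemma expect_indep_apply {ι : Type} [Fintype ι] [DecidableEq ι] (μ : ι → PMF α) (i : ι)
    (f : α → ℝ) : expect (indep μ) (fun ω => f (ω i)) = expect (μ i) f := by
  have h := expect_indep_prod μ (fun k a => if k = i then f a else 1)
  simp only [Finset.prod_ite_eq', Finset.mem_univ, if_true] at h
  rw [h, Finset.prod_eq_single i]
  · simp
  · intro k _ hk
    simp [hk, expect_const]
  · simp

end Expect

/-! ### Age dynamics and the law of one slot -/

lemma age_pos {N R n : ℕ} (i : Fin R) (H : Fin n → Slot N R) : 1 ≤ age i H := by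
  have : (Finset.univ.filter fun k => ((H k).2 i).2 = true).sup (fun k => (k : ℕ) + 1) ≤ n :=
    Finset.sup_le fun k _ => k.2
  unfold age
  omega

lemma age_snoc {N R n : ℕ} (i : Fin R) (H : Fin n → Slot N R) (x : Slot N R) :
    age i (Fin.snoc (α := fun _ => Slot N R) H x) =
      if (x.2 i).2 = true then 1 else age i H + 1 := by
  have hle : (Finset.univ.filter fun k => ((H k).2 i).2 = true).sup (fun k => (k : ℕ) + 1) ≤ n :=
    Finset.sup_le fun k _ => k.2
  have key : (Finset.univ.filter fun k =>
      (((Fin.snoc (α := fun _ => Slot N R) H x : Fin (n + 1) → Slot N R) k).2 i).2 = true).sup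
        (fun k => (k : ℕ) + 1) =
      (Finset.univ.filter fun k => ((H k).2 i).2 = true).sup (fun k => (k : ℕ) + 1) ⊔
        (if (x.2 i).2 = true then n + 1 else 0) := by
    refine le_antisymm (Finset.sup_le fun k hk => ?_) (sup_le (Finset.sup_le fun k hk => ?_) ?_)
    · induction k using Fin.lastCases with
      | last =>
        simp only [Finset.mem_filter, Fin.snoc_last] at hk
        simp [hk.2]
      | cast k =>
        simp only [Finset.mem_filter, Fin.snoc_castSucc] at hk
        exact le_sup_of_le_left
          (Finset.le_sup (f := fun k : Fin n => (k : ℕ) + 1) (by simp [hk.2]))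
    · refine Finset.le_sup_of_le (b := k.castSucc) ?_ (by simp)
      simpa using hk
    · split_ifs with h
      · refine Finset.le_sup_of_le (b := Fin.last n) ?_ (by simp)
        simpa using h
      · exact Nat.zero_le _
  unfold age
  rw [key]
  split_ifs with h
  · rw [sup_of_le_right (by omega)]
    omega
  · rw [sup_of_le_left (by omega)]
    omega

namespace Network

variable {N R : ℕ} (S : Network N R)

/-- The probability that a scheduled request is served. -/
def rate (i : Fin R) : ℝ := S.q (S.G i).card * S.v i

lemma rate_pos (i : Fin R) : 0 < S.rate i :=
  mul_pos (S.q_mem i).1 (Finset.prod_pos fun j _ => (S.p_mem j).1)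

lemma rate_le_one (i : Fin R) : S.rate i ≤ 1 :=
  mul_le_one₀ (S.q_mem i).2 (Finset.prod_nonneg fun j _ => (S.p_mem j).1.le)
    (Finset.prod_le_one (fun j _ => (S.p_mem j).1.le) fun j _ => (S.p_mem j).2)

/-- The indicator that all users of `G i` succeed is a product over users, so by independence its
mean is `v i`. -/
lemma expect_attemptLaw (i : Fin R) (f : Bool → ℝ) :
    expect (S.attemptLaw i) (fun x => f x.2) =
      S.rate i * f true + (1 - S.rate i) * f false := by
  have h1 : ∀ b : Fin N → Bool,
      expect ((if ∀ j ∈ S.G i, b j = true then coin (S.q (S.G i).card) (S.q_mem i)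
        else PMF.pure false).map fun d => (b, d)) (fun x => f x.2) =
      f false + S.q (S.G i).card * (f true - f false) *
        ∏ j, (if j ∈ S.G i then (if b j = true then 1 else 0) else 1) := by
    intro b
    rw [expect_map]
    by_cases hb : ∀ j ∈ S.G i, b j = true
    · rw [if_pos hb, expect_coin, Finset.prod_eq_one]
      · ring
      · intro j _
        split_ifs with hj hbj
        · rfl
        · exact absurd (hb j hj) hbj
        · rfl
    · rw [if_neg hb, expect_pure]
      push Not at hb
      obtain ⟨j, hj, hbj⟩ := hb
      rw [Finset.prod_eq_zero (Finset.mem_univ j)]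
      · ring
      · simp [hj, hbj]
  rw [attemptLaw, expect_bind]
  simp only [h1]
  rw [expect_add, expect_const, expect_const_mul,
    expect_indep_prod _ (fun j b => if j ∈ S.G i then (if b = true then (1 : ℝ) else 0) else 1)]
  have h2 : ∏ j, expect (if j ∈ S.G i then coin (S.p j) (S.p_mem j) else PMF.pure false)
      (fun b => if j ∈ S.G i then (if b = true then (1 : ℝ) else 0) else 1) = S.v i := by
    rw [v, ← Finset.prod_subset (Finset.subset_univ (S.G i))]
    · refine Finset.prod_congr rfl fun j hj => ?_
      simp [hj, expect_coin]
    · intro j _ hj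
      simp [hj, expect_const]
  rw [h2, rate]
  ring

/-- The mean of `V` at the next age of request `i`, from age `a`, if the set `U` is scheduled. -/
def nextValue (i : Fin R) (V : ℕ → ℝ) (a : ℕ) (U : Finset (Fin R)) : ℝ :=
  if i ∈ U then S.rate i * V 1 + (1 - S.rate i) * V (a + 1) else V (a + 1)

lemma expect_slotLaw (i : Fin R) (U : Finset (Fin R)) (f : Bool → ℝ) :
    expect (S.slotLaw U) (fun o => f (o i).2) =
      if i ∈ U then S.rate i * f true + (1 - S.rate i) * f false else f false := by
  rw [slotLaw, expect_indep_apply _ i (fun x : Attempt N => f x.2)]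
  split_ifs
  · exact S.expect_attemptLaw i f
  · exact expect_pure _ _

/-- The expectation of `V` at the age of request `i` at the beginning of slot `n + 1`. -/
def expectedValue (π : Policy N R) (i : Fin R) (V : ℕ → ℝ) (n : ℕ) : ℝ :=
  expect (S.historyLaw π n) fun H => V (age i H)

lemma expectedValue_zero (π : Policy N R) (i : Fin R) (V : ℕ → ℝ) :
    S.expectedValue π i V 0 = V 1 := by
  rw [expectedValue, historyLaw, expect_pure]
  simp [age]

lemma expectedValue_succ (π : Policy N R) (i : Fin R) (V : ℕ → ℝ) (n : ℕ) :
    S.expectedValue π i V (n + 1) = expect (S.historyLaw π n) fun H =>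
      expect (π n H) fun U => S.nextValue i V (age i H) U := by
  rw [expectedValue, historyLaw, expect_bind]
  congr 1
  funext H
  rw [expect_bind]
  congr 1
  funext U
  rw [expect_map]
  simp only [age_snoc, apply_ite V]
  have h := S.expect_slotLaw i U (fun d => if d = true then V 1 else V (age i H + 1))
  simpa [nextValue] using h

lemma expectedCost_eq (π : Policy N R) (i : Fin R) (τ : ℝ) (n : ℕ) :
    S.expectedCost π i τ n = expect (S.historyLaw π n) fun H => expect (π n H) fun U =>
      (age i H : ℝ) + τ * ((S.G i).card : ℝ) * (if i ∈ U then 1 else 0) := by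
  simp only [expectedCost, expect, Finset.mul_sum, mul_assoc]

/-- One dynamic-programming step: it lets pointwise Bellman relations be averaged over histories and
telescoped. -/
lemma expectedCost_add_expectedValue_succ (π : Policy N R) (i : Fin R) (τ : ℝ) (V : ℕ → ℝ)
    (n : ℕ) :
    S.expectedCost π i τ n + S.expectedValue π i V (n + 1) =
      expect (S.historyLaw π n) fun H => expect (π n H) fun U =>
        S.actionValue i τ V (age i H) (decide (i ∈ U)) := by
  rw [expectedCost_eq, expectedValue_succ, ← expect_add]
  congr 1
  funext H
  rw [← expect_add]
  congr 1
  funext U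
  by_cases h : i ∈ U <;> simp [h, nextValue, actionValue, rate]

/-! ### Verification of the optimality equation -/

lemma le_expectedCost (π : Policy N R) (i : Fin R) {τ g : ℝ} {V : ℕ → ℝ}
    (h : ∀ s, 1 ≤ s → ∀ a, g + V s ≤ S.actionValue i τ V s a) (n : ℕ) :
    g + S.expectedValue π i V n ≤
      S.expectedCost π i τ n + S.expectedValue π i V (n + 1) := by
  rw [expectedCost_add_expectedValue_succ, expectedValue, ← expect_const (S.historyLaw π n) g,
    ← expect_add]
  exact expect_mono _ fun H => le_expect _ fun U => h _ (age_pos i H) _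

lemma le_sum_expectedCost (π : Policy N R) (i : Fin R) {τ g : ℝ} {V : ℕ → ℝ}
    (h : ∀ s, 1 ≤ s → ∀ a, g + V s ≤ S.actionValue i τ V s a) (T : ℕ) :
    T * g + V 1 ≤ ∑ n ∈ Finset.range T, S.expectedCost π i τ n + S.expectedValue π i V T := by
  induction T with
  | zero => simp [expectedValue_zero]
  | succ T ih =>
    rw [Finset.sum_range_succ]
    push_cast
    linarith [S.le_expectedCost π i h T]

/-- The deterministic policy that schedules request `i` alone, at the ages selected by `a`. -/
def stationaryPolicy (i : Fin R) (a : ℕ → Bool) : Policy N R :=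
  fun _ H => PMF.pure (if a (age i H) then {i} else ∅)

lemma sum_expectedCost_stationaryPolicy (i : Fin R) {τ g : ℝ} {V : ℕ → ℝ} {a : ℕ → Bool}
    (h : ∀ s, 1 ≤ s → g + V s = S.actionValue i τ V s (a s)) (T : ℕ) :
    ∑ n ∈ Finset.range T, S.expectedCost (stationaryPolicy i a) i τ n
      + S.expectedValue (stationaryPolicy i a) i V T = T * g + V 1 := by
  induction T with
  | zero => simp [expectedValue_zero]
  | succ T ih =>
    have h1 := S.expectedCost_add_expectedValue_succ (stationaryPolicy i a) i τ V T
    have h2 : (fun H : Fin T → Slot N R => expect (stationaryPolicy i a T H) fun U =>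
        S.actionValue i τ V (age i H) (decide (i ∈ U))) = fun H => g + V (age i H) := by
      funext H
      rw [stationaryPolicy, expect_pure, h _ (age_pos i H)]
      cases a (age i H) <;> simp
    rw [h2, expect_add, expect_const] at h1
    rw [Finset.sum_range_succ]
    push_cast
    rw [expectedValue] at ih
    linarith

lemma expectedValue_le_expectedCost (π : Policy N R) (i : Fin R) {τ : ℝ} (hτ : 0 ≤ τ) (n : ℕ) :
    S.expectedValue π i (fun s => (s : ℝ)) n ≤ S.expectedCost π i τ n := by
  rw [expectedCost_eq, expectedValue]
  refine expect_mono _ fun H => le_expect _ fun U => le_add_of_nonneg_right ?_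
  positivity

lemma expectedValue_le_linear (π : Policy N R) (i : Fin R) {V : ℕ → ℝ} {A C : ℝ}
    (h : ∀ s, 1 ≤ s → V s ≤ A * s + C) (n : ℕ) :
    S.expectedValue π i V n ≤ A * S.expectedValue π i (fun s => (s : ℝ)) n + C := by
  have h1 : S.expectedValue π i V n ≤
      expect (S.historyLaw π n) fun H => A * (age i H : ℝ) + C :=
    expect_mono _ fun H => h _ (age_pos i H)
  rwa [expect_add, expect_const, expect_const_mul] at h1

/-- Telescoping leaves the terminal term `E V`, which need not be `o(T)` for an arbitrary policy. If
the average cost stayed below some `g' < g`, this term would grow linearly; since `V` is at most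
linear, so would the mean age. Each slot would then eventually cost at least `g`, which contradicts
the average. -/
lemma le_averageCost (π : Policy N R) (i : Fin R) {τ g A C : ℝ} {V : ℕ → ℝ} (hτ : 0 ≤ τ)
    (hA : 0 < A) (hV : ∀ s, 1 ≤ s → V s ≤ A * s + C)
    (h : ∀ s, 1 ≤ s → ∀ a, g + V s ≤ S.actionValue i τ V s a) :
    (g : EReal) ≤ S.averageCost π i τ := by
  by_contra! hlt
  obtain ⟨g', hg1, hg2⟩ := EReal.lt_iff_exists_real_btwn.1 hlt
  have hg2 : g' < g := by exact_mod_cast hg2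
  obtain ⟨T₀, hT₀⟩ := eventually_atTop.1 (eventually_lt_of_limsup_lt hg1)
  set X : ℕ → ℝ := fun T => ∑ n ∈ Finset.range T, S.expectedCost π i τ n with hX
  have hsum : ∀ T, T₀ ≤ T → 1 ≤ T → X T < g' * T := by
    intro T h1 h2
    have h3 : 1 / (T : ℝ) * X T < g' := by exact_mod_cast hT₀ T h1
    have h4 : (0 : ℝ) < T := by exact_mod_cast h2
    rwa [one_div, inv_mul_eq_div, div_lt_iff₀ h4] at h3
  -- The mean age grows without bound, hence so does the mean cost.
  have hgrow : ∀ᶠ T : ℕ in atTop, g ≤ S.expectedCost π i τ T := by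
    have h1 : Tendsto (fun T : ℕ => (T : ℝ) * (g - g')) atTop atTop :=
      tendsto_natCast_atTop_atTop.atTop_mul_const (sub_pos.2 hg2)
    filter_upwards [h1.eventually_ge_atTop (A * g + C - V 1), eventually_ge_atTop T₀,
      eventually_ge_atTop 1] with T h2 h3 h4
    have h5 := S.le_sum_expectedCost π i h T
    have h6 := S.expectedValue_le_linear π i hV T
    have h7 := hsum T h3 h4
    have h8 : A * g ≤ A * S.expectedValue π i (fun s => (s : ℝ)) T := by
      simp only [hX] at h7
      nlinarith
    exact (le_of_mul_le_mul_left h8 hA).trans (S.expectedValue_le_expectedCost π i hτ T)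
  obtain ⟨T₁, hT₁⟩ := eventually_atTop.1 hgrow
  have hlin : ∀ k : ℕ, X T₁ + k * g ≤ X (T₁ + k) := by
    intro k
    induction k with
    | zero => simp
    | succ k ih =>
      have h1 : X (T₁ + (k + 1)) = X (T₁ + k) + S.expectedCost π i τ (T₁ + k) :=
        Finset.sum_range_succ _ _
      push_cast
      linarith [hT₁ (T₁ + k) (Nat.le_add_right _ _)]
  have h1 : Tendsto (fun T : ℕ => (T : ℝ) * (g - g')) atTop atTop :=
    tendsto_natCast_atTop_atTop.atTop_mul_const (sub_pos.2 hg2)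
  obtain ⟨k, hk1, hk2, hk3⟩ := ((h1.eventually_ge_atTop (T₁ * g' - X T₁)).and
    ((eventually_ge_atTop T₀).and (eventually_ge_atTop 1))).exists
  have h2 := hsum (T₁ + k) (by omega) (by omega)
  have h3 := hlin k
  push_cast at h2
  linarith

/-- Here telescoping is exact, and the lower bound on `V` reduces the boundary term to `(V 1 - B) /
T`. -/
lemma averageCost_stationaryPolicy_le (i : Fin R) {τ g B : ℝ} {V : ℕ → ℝ} {a : ℕ → Bool}
    (hB : ∀ s, 1 ≤ s → B ≤ V s) (h : ∀ s, 1 ≤ s → g + V s = S.actionValue i τ V s (a s)) :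
    S.averageCost (stationaryPolicy i a) i τ ≤ g := by
  have hlim : Tendsto (fun T : ℕ => ((g + (V 1 - B) / (T : ℝ) : ℝ) : EReal)) atTop
      (nhds (g : EReal)) := by
    rw [EReal.tendsto_coe]
    simpa using (tendsto_const_div_atTop_nhds_zero_nat (V 1 - B)).const_add g
  rw [← hlim.limsup_eq]
  refine limsup_le_limsup ?_
  filter_upwards [eventually_ge_atTop 1] with T hT
  have hT : (0 : ℝ) < T := by exact_mod_cast hT
  rw [EReal.coe_le_coe_iff, one_div, inv_mul_eq_div, div_le_iff₀ hT, add_mul,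
    div_mul_cancel₀ _ hT.ne']
  have h1 := S.sum_expectedCost_stationaryPolicy i h T
  have h2 : B ≤ S.expectedValue (stationaryPolicy i a) i V T :=
    le_expect _ fun H => hB _ (age_pos i H)
  linarith

/-- Verification theorem for the average-cost optimality equation. -/
lemma optimalCost_eq (i : Fin R) {τ g A B C : ℝ} {V : ℕ → ℝ} {a : ℕ → Bool} (hτ : 0 ≤ τ)
    (hA : 0 < A) (hV : ∀ s, 1 ≤ s → V s ≤ A * s + C) (hB : ∀ s, 1 ≤ s → B ≤ V s)
    (hle : ∀ s, 1 ≤ s → ∀ a, g + V s ≤ S.actionValue i τ V s a)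
    (heq : ∀ s, 1 ≤ s → g + V s = S.actionValue i τ V s (a s)) :
    S.optimalCost i τ = g :=
  le_antisymm ((iInf_le _ _).trans (S.averageCost_stationaryPolicy_le i hB heq))
    (le_iInf fun π => S.le_averageCost π i hτ hA hV hle)

end Network

/-! ### Explicit solution for threshold policies -/

/-- The cost of one activation at which the two actions are equally good at age `s`, if an
activation succeeds with probability `m`. -/
def criticalCost (m : ℝ) (s : ℕ) : ℝ := (s : ℝ) * (m * s - m + 2) / 2

/-- The average cost of activating exactly at the ages `s ≥ n`, at cost `c` per activation. -/
def thresholdCost (m c : ℝ) (n : ℕ) : ℝ :=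
  (m * n * (n - 1) / 2 + (n - 1) + 1 / m + c) / (m * (n - 1) + 1)

/-- The relative value function of the policy that activates exactly at the ages `s ≥ n`. -/
def thresholdValue (m c : ℝ) (n s : ℕ) : ℝ :=
  if s ≤ n then (s - 1) * thresholdCost m c n - s * (s - 1) / 2
  else s / m + (c - thresholdCost m c n + 1 / m - 1) / m

section Threshold

variable {m c : ℝ} {n s : ℕ}

lemma thresholdCost_mul (hm : 0 < m) (hn : 1 ≤ n) :
    thresholdCost m c n * (m * (n - 1) + 1) = m * n * (n - 1) / 2 + (n - 1) + 1 / m + c := by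
  have : (1 : ℝ) ≤ n := by exact_mod_cast hn
  have h : 0 < m * ((n : ℝ) - 1) + 1 := by nlinarith
  rw [thresholdCost, div_mul_cancel₀ _ h.ne']

lemma thresholdValue_one (hn : 1 ≤ n) : thresholdValue m c n 1 = 0 := by
  simp [thresholdValue, hn]

lemma thresholdValue_of_le (h : s ≤ n) :
    thresholdValue m c n s = (s - 1) * thresholdCost m c n - s * (s - 1) / 2 := if_pos h

/-- The linear branch is valid at `s = n` too: agreement of the two branches there is exactly the
equation defining `thresholdCost`. -/
lemma thresholdValue_of_ge (hm : 0 < m) (hn : 1 ≤ n) (h : n ≤ s) :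
    thresholdValue m c n s = s / m + (c - thresholdCost m c n + 1 / m - 1) / m := by
  rcases h.eq_or_lt with rfl | h
  · have h1 := thresholdCost_mul (c := c) hm hn
    rw [thresholdValue_of_le le_rfl]
    generalize thresholdCost m c n = g at *
    field_simp at h1 ⊢
    linarith
  · exact if_neg h.not_ge

/-- By `mul_thresholdValue_of_ge` at `s = n`, this bound says that activation is no worse than
passivity at age `n`. -/
lemma thresholdCost_le (hm : 0 < m) (hn : 1 ≤ n) (h : c ≤ criticalCost m n) :
    thresholdCost m c n ≤ n + 1 / m := by
  have h1 := thresholdCost_mul (c := c) hm hn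
  have h2 : (1 : ℝ) ≤ n := by exact_mod_cast hn
  have h3 : 0 < m * ((n : ℝ) - 1) + 1 := by nlinarith
  refine le_of_mul_le_mul_right ?_ h3
  rw [h1]
  have h4 : (n + 1 / m) * (m * ((n : ℝ) - 1) + 1) = m * n * (n - 1) + 2 * n - 1 + 1 / m := by
    field_simp
    ring
  rw [h4]
  unfold criticalCost at h
  linarith

lemma thresholdCost_lt (hm : 0 < m) (hn : 1 ≤ n) (h : c < criticalCost m n) :
    thresholdCost m c n < n + 1 / m := by
  have h1 := thresholdCost_mul (c := c) hm hn
  have h2 : (1 : ℝ) ≤ n := by exact_mod_cast hn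
  have h3 : 0 < m * ((n : ℝ) - 1) + 1 := by nlinarith
  refine lt_of_mul_lt_mul_right ?_ h3.le
  rw [h1]
  have h4 : (n + 1 / m) * (m * ((n : ℝ) - 1) + 1) = m * n * (n - 1) + 2 * n - 1 + 1 / m := by
    field_simp
    ring
  rw [h4]
  unfold criticalCost at h
  linarith

/-- The mirror condition at age `n - 1`: it amounts to `m * thresholdValue m c n n ≤ c`. -/
lemma le_thresholdCost (hm : 0 < m) (hn : 1 ≤ n) (h : criticalCost m (n - 1) ≤ c) :
    (n : ℝ) - 1 + 1 / m ≤ thresholdCost m c n := by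
  have h1 := thresholdCost_mul (c := c) hm hn
  have h2 : (1 : ℝ) ≤ n := by exact_mod_cast hn
  have h3 : 0 < m * ((n : ℝ) - 1) + 1 := by nlinarith
  refine le_of_mul_le_mul_right ?_ h3
  rw [h1]
  have h4 : (n - 1 + 1 / m) * (m * ((n : ℝ) - 1) + 1) =
      m * (n - 1) * (n - 1) + 2 * (n - 1) + 1 / m := by
    field_simp
    ring
  rw [h4]
  unfold criticalCost at h
  push_cast [hn] at h
  linarith

/-- Below the threshold the passive action is optimal. -/
lemma mul_thresholdValue_le (hm : 0 < m) (hm1 : m ≤ 1) (hc : criticalCost m (n - 1) ≤ c) (hs : s < n) :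
    m * thresholdValue m c n (s + 1) ≤ c := by
  have hn : 1 ≤ n := by omega
  have h1 := le_thresholdCost hm hn hc
  have h2 := thresholdValue_of_ge (c := c) hm hn le_rfl
  -- The value increases up to `n`, so `s + 1 = n` is the worst case; `h6` is the factored
  -- difference of the two values.
  have h3 : thresholdValue m c n (s + 1) ≤ thresholdValue m c n n := by
    rw [thresholdValue_of_le (s := s + 1) hs, thresholdValue_of_le le_rfl]
    have h4 : (s : ℝ) + 1 ≤ n := by exact_mod_cast hs
    have h5 : 1 ≤ 1 / m := (one_le_div hm).2 hm1
    have h6 : 0 ≤ ((n : ℝ) - (s + 1)) * (thresholdCost m c n - (n + s) / 2) :=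
      mul_nonneg (by linarith) (by linarith)
    push_cast
    linarith
  refine (mul_le_mul_of_nonneg_left h3 hm.le).trans ?_
  rw [h2]
  have h6 : m * (n / m + (c - thresholdCost m c n + 1 / m - 1) / m) =
      n + (c - thresholdCost m c n + 1 / m - 1) := by
    field_simp
  linarith

lemma mul_thresholdValue_of_ge (hm : 0 < m) (hn : 1 ≤ n) (hs : n ≤ s) :
    m * thresholdValue m c n (s + 1) = s + (c - thresholdCost m c n + 1 / m) := by
  rw [thresholdValue_of_ge hm hn (by omega)]
  push_cast
  field_simp
  ring

lemma le_mul_thresholdValue (hm : 0 < m) (hn : 1 ≤ n) (hc : c ≤ criticalCost m n)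
    (hs : n ≤ s) : c ≤ m * thresholdValue m c n (s + 1) := by
  rw [mul_thresholdValue_of_ge hm hn hs]
  have : (n : ℝ) ≤ s := by exact_mod_cast hs
  linarith [thresholdCost_le hm hn hc]

lemma lt_mul_thresholdValue (hm : 0 < m) (hn : 1 ≤ n) (hc : c < criticalCost m n)
    (hs : n ≤ s) : c < m * thresholdValue m c n (s + 1) := by
  rw [mul_thresholdValue_of_ge hm hn hs]
  have : (n : ℝ) ≤ s := by exact_mod_cast hs
  linarith [thresholdCost_lt hm hn hc]

lemma thresholdValue_passive (hs : s < n) :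
    thresholdCost m c n + thresholdValue m c n s = s + thresholdValue m c n (s + 1) := by
  rw [thresholdValue_of_le hs.le, thresholdValue_of_le (s := s + 1) hs]
  push_cast
  ring

lemma thresholdValue_active (hm : 0 < m) (hn : 1 ≤ n) (hs : n ≤ s) :
    thresholdCost m c n + thresholdValue m c n s =
      s + c + (1 - m) * thresholdValue m c n (s + 1) := by
  rw [thresholdValue_of_ge hm hn hs, thresholdValue_of_ge hm hn (by omega : n ≤ s + 1)]
  push_cast
  field_simp
  ring

/-- Up to `n` the value factors as `(s - 1) * (g - s / 2)` with `g ≥ n`, where `g` is the threshold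
cost; beyond `n`, optimality of activation bounds `m` times the value below by `c`. -/
lemma thresholdValue_nonneg (hm : 0 < m) (hm1 : m ≤ 1) (hc : criticalCost m (n - 1) ≤ c)
    (hc' : 0 ≤ c) (hn : 1 ≤ n) (hcn : c ≤ criticalCost m n) (hs : 1 ≤ s) :
    0 ≤ thresholdValue m c n s := by
  rcases le_or_gt s n with h | h
  · rw [thresholdValue_of_le h]
    have h1 := le_thresholdCost hm hn hc
    have h2 : (1 : ℝ) ≤ s := by exact_mod_cast hs
    have h3 : (s : ℝ) ≤ n := by exact_mod_cast h
    have h5 : 1 ≤ 1 / m := (one_le_div hm).2 hm1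
    have h6 : 0 ≤ ((s : ℝ) - 1) * (thresholdCost m c n - s / 2) :=
      mul_nonneg (by linarith) (by linarith)
    linarith
  · obtain ⟨k, rfl⟩ : ∃ k, s = k + 1 := ⟨s - 1, by omega⟩
    exact nonneg_of_mul_nonneg_right
      (hc'.trans (le_mul_thresholdValue hm hn hcn (by omega : n ≤ k))) hm

lemma thresholdValue_le_linear (hm : 0 < m) (hn : 1 ≤ n) :
    ∃ C, ∀ s, 1 ≤ s → thresholdValue m c n s ≤ 1 / m * s + C := by
  refine ⟨|(c - thresholdCost m c n + 1 / m - 1) / m| + n * |thresholdCost m c n|,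
    fun s hs => ?_⟩
  have h2 : (1 : ℝ) ≤ s := by exact_mod_cast hs
  have h4 : 0 ≤ 1 / m * (s : ℝ) := by positivity
  have h5 := abs_nonneg ((c - thresholdCost m c n + 1 / m - 1) / m)
  rcases le_or_gt s n with h | h
  · rw [thresholdValue_of_le h]
    have h3 : (s : ℝ) ≤ n := by exact_mod_cast h
    have h6 : ((s : ℝ) - 1) * thresholdCost m c n ≤ n * |thresholdCost m c n| :=
      (mul_le_mul_of_nonneg_left (le_abs_self _) (by linarith)).trans
        (mul_le_mul_of_nonneg_right (by linarith) (abs_nonneg _))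
    have h7 : 0 ≤ (s : ℝ) * (s - 1) / 2 := by
      have : 0 ≤ (s : ℝ) - 1 := by linarith
      positivity
    linarith
  · rw [thresholdValue_of_ge hm hn h.le]
    have h6 : 0 ≤ (n : ℝ) * |thresholdCost m c n| := by positivity
    have h7 := le_abs_self ((c - thresholdCost m c n + 1 / m - 1) / m)
    have h8 : (s : ℝ) / m = 1 / m * s := by ring
    linarith

end Threshold

/-! ### Critical costs and rigidity of solutions -/

lemma criticalCost_zero (m : ℝ) : criticalCost m 0 = 0 := by simp [criticalCost]

lemma le_criticalCost {m : ℝ} (hm : 0 < m) (s : ℕ) : (s : ℝ) ≤ criticalCost m s := by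
  rcases Nat.eq_zero_or_pos s with rfl | hs
  · simp [criticalCost]
  · have : (1 : ℝ) ≤ s := by exact_mod_cast hs
    unfold criticalCost
    nlinarith [mul_nonneg (mul_nonneg hm.le (Nat.cast_nonneg (α := ℝ) s)) (sub_nonneg.2 this)]

lemma criticalCost_le_succ {m : ℝ} (hm : 0 < m) (s : ℕ) :
    criticalCost m s ≤ criticalCost m (s + 1) := by
  unfold criticalCost
  push_cast
  nlinarith [mul_nonneg hm.le (Nat.cast_nonneg (α := ℝ) s)]

/-- A threshold `n ≤ s` between the critical costs of which a cost below that of `s` lies. -/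
lemma exists_threshold {m c : ℝ} {s : ℕ} (hc : 0 ≤ c) (hcs : c < criticalCost m s) :
    ∃ n, 1 ≤ n ∧ n ≤ s ∧ criticalCost m (n - 1) ≤ c ∧ c < criticalCost m n := by
  classical
  have hex : ∃ n, c < criticalCost m n := ⟨s, hcs⟩
  have h0 : Nat.find hex ≠ 0 := fun h => by
    have := Nat.find_spec hex
    rw [h, criticalCost_zero] at this
    linarith
  exact ⟨Nat.find hex, Nat.one_le_iff_ne_zero.2 h0, Nat.find_min' hex hcs,
    not_lt.1 (Nat.find_min hex (Nat.sub_lt (Nat.pos_of_ne_zero h0) one_pos)), Nat.find_spec hex⟩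

/-- Both slopes, `1` and `1 - m`, are positive, so the optimality equation can be solved for the
value at `s + 1` given that at `s`. -/
lemma min_affine_strictMono {m c : ℝ} (h1 : m < 1) :
    StrictMono fun x : ℝ => min x (c + (1 - m) * x) := fun x y h =>
  min_lt_min h (by nlinarith)

/-- If an activation can fail, a solution of the optimality equation is determined up to a
constant. -/
lemma relativeValue_unique {m c g : ℝ} (h1 : m < 1) {D D' : ℕ → ℝ}
    (hD : ∀ s, 1 ≤ s → g + D s = s + min (D (s + 1)) (c + (1 - m) * D (s + 1)))
    (hD' : ∀ s, 1 ≤ s → g + D' s = s + min (D' (s + 1)) (c + (1 - m) * D' (s + 1)))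
    (h : D 1 = D' 1) : ∀ s, 1 ≤ s → D s = D' s := by
  intro s hs
  induction s, hs using Nat.le_induction with
  | base => exact h
  | succ s hs ih =>
    refine (min_affine_strictMono (c := c) h1).injective ?_
    linarith [hD s hs, hD' s hs]

/-- If activations never fail, a solution of the optimality equation that is bounded below is
strictly active at the ages above `g - 1`. -/
lemma lt_of_bddBelow {c g B : ℝ} {D : ℕ → ℝ} {s : ℕ} (hs : g < s + 1)
    (hB : ∀ k, 1 ≤ k → B ≤ D k) (hD : ∀ k, 1 ≤ k → g + D k = k + min (D (k + 1)) c) :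
    c < D (s + 1) := by
  by_contra! hle
  -- Passivity, once weakly preferred, persists, since the active branch would force `c < c`. Each
  -- passive step lowers `D` by at least `s + 1 - g`, so `D` tends to minus infinity.
  have key : ∀ k : ℕ, D (s + 1 + k) ≤ c - k * (s + 1 - g) := by
    intro k
    induction k with
    | zero => simpa using hle
    | succ k ih =>
      have h1 := hD (s + 1 + k) (by omega)
      have h2 : 0 ≤ (k : ℝ) * (s + 1 - g) :=
        mul_nonneg (Nat.cast_nonneg k) (by linarith)
      have h3 : (0 : ℝ) ≤ k := Nat.cast_nonneg k
      push_cast at h1 ⊢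
      rw [← add_assoc]
      rcases min_choice (D (s + 1 + k + 1)) c with h4 | h4
      · rw [h4] at h1
        linarith
      · rw [h4] at h1
        linarith
  obtain ⟨k, hk⟩ := exists_nat_gt ((c - B) / (s + 1 - g))
  rw [div_lt_iff₀ (by linarith)] at hk
  linarith [key k, hB (s + 1 + k) (by omega)]

/-! ### Passive ages and the index -/

namespace Network

variable {N R : ℕ} (S : Network N R)

lemma actionValue_true (i : Fin R) (τ : ℝ) (V : ℕ → ℝ) (s : ℕ) :
    S.actionValue i τ V s true =
      s + τ * (S.G i).card + (S.rate i * V 1 + (1 - S.rate i) * V (s + 1)) := rfl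

lemma actionValue_false (i : Fin R) (τ : ℝ) (V : ℕ → ℝ) (s : ℕ) :
    S.actionValue i τ V s false = s + V (s + 1) := rfl

lemma thresholdValue_isRelativeValue (i : Fin R) {τ : ℝ} {n : ℕ} (hτ : 0 ≤ τ) (hn : 1 ≤ n)
    (h1 : criticalCost (S.rate i) (n - 1) ≤ τ * (S.G i).card)
    (h2 : τ * (S.G i).card ≤ criticalCost (S.rate i) n) :
    S.optimalCost i τ = thresholdCost (S.rate i) (τ * (S.G i).card) n ∧
      S.IsRelativeValue i τ (thresholdValue (S.rate i) (τ * (S.G i).card) n) := by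
  have hm := S.rate_pos i
  have hc : 0 ≤ τ * (S.G i).card := by positivity
  have hnonneg : ∀ s, 1 ≤ s → 0 ≤ thresholdValue (S.rate i) (τ * (S.G i).card) n s :=
    fun s hs => thresholdValue_nonneg hm (S.rate_le_one i) h1 hc hn h2 hs
  obtain ⟨C, hC⟩ := thresholdValue_le_linear (c := τ * (S.G i).card) hm hn
  have hact : ∀ s, 1 ≤ s → thresholdCost (S.rate i) (τ * (S.G i).card) n +
      thresholdValue (S.rate i) (τ * (S.G i).card) n s =
      S.actionValue i τ (thresholdValue (S.rate i) (τ * (S.G i).card) n) s (decide (n ≤ s)) := by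
    intro s _
    by_cases h : n ≤ s
    · rw [decide_eq_true h, actionValue_true, thresholdValue_one hn, thresholdValue_active hm hn h]
      ring
    · rw [decide_eq_false h, actionValue_false, thresholdValue_passive (not_le.1 h)]
  have hmin : ∀ s, 1 ≤ s → thresholdCost (S.rate i) (τ * (S.G i).card) n +
      thresholdValue (S.rate i) (τ * (S.G i).card) n s =
      min (S.actionValue i τ (thresholdValue (S.rate i) (τ * (S.G i).card) n) s false)
        (S.actionValue i τ (thresholdValue (S.rate i) (τ * (S.G i).card) n) s true) := by
    intro s hs
    rw [hact s hs]
    by_cases h : n ≤ s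
    · rw [decide_eq_true h, min_eq_right]
      rw [actionValue_true, actionValue_false, thresholdValue_one hn]
      linarith [le_mul_thresholdValue hm hn h2 h]
    · rw [decide_eq_false h, min_eq_left]
      rw [actionValue_true, actionValue_false, thresholdValue_one hn]
      linarith [mul_thresholdValue_le hm (S.rate_le_one i) h1 (not_le.1 h)]
  have hopt := S.optimalCost_eq i hτ (one_div_pos.2 hm) hC hnonneg
    (fun s hs a => by
      rw [hmin s hs]
      cases a
      · exact min_le_left _ _
      · exact min_le_right _ _) hact
  exact ⟨hopt, ⟨0, hnonneg⟩, _, hopt.symm, hmin⟩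

lemma mem_passiveSet_criticalCost (i : Fin R) {τ : ℝ} {s : ℕ} (hτ : 0 ≤ τ) (hs : 1 ≤ s)
    (h : τ * (S.G i).card = criticalCost (S.rate i) s) : s ∈ S.passiveSet i τ := by
  have hm := S.rate_pos i
  -- At this critical cost the thresholds `s` and `s + 1` tie; `s + 1` is the one that leaves `s`
  -- passive.
  refine ⟨hs, _, (S.thresholdValue_isRelativeValue i (n := s + 1) hτ (by omega) h.ge
    (h.le.trans (criticalCost_le_succ hm s))).2, ?_⟩
  rw [actionValue_true, actionValue_false, thresholdValue_one (by omega)]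
  linarith [mul_thresholdValue_le (n := s + 1) hm (S.rate_le_one i) h.ge (Nat.lt_succ_self s)]

lemma criticalCost_le_of_mem_passiveSet (i : Fin R) {τ : ℝ} {s : ℕ} (hτ : 0 ≤ τ)
    (h : s ∈ S.passiveSet i τ) : criticalCost (S.rate i) s ≤ τ * (S.G i).card := by
  by_contra! hlt
  obtain ⟨hs, V, ⟨⟨B, hB⟩, g, hg, hV⟩, hpas⟩ := h
  have hm := S.rate_pos i
  obtain ⟨n, hn, hns, h1, h2⟩ := exists_threshold (by positivity) hlt
  obtain ⟨hopt, -, g', hg', hV'⟩ := S.thresholdValue_isRelativeValue i hτ hn h1 h2.le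
  set c := τ * (S.G i).card with hc
  have hgg : g' = g := by exact_mod_cast hg'.trans hg.symm
  have hgt : g = thresholdCost (S.rate i) c n := by exact_mod_cast hg.trans hopt
  subst hgg
  -- Normalising by `W 1` removes the reset value and the free additive constant.
  have hD : ∀ W : ℕ → ℝ, (∀ k, 1 ≤ k → g' + W k =
      min (S.actionValue i τ W k false) (S.actionValue i τ W k true)) →
      ∀ k, 1 ≤ k → g' + (W k - W 1) = k + min (W (k + 1) - W 1)
        (c + (1 - S.rate i) * (W (k + 1) - W 1)) := by
    intro W hW k hk
    rw [← min_add_add_left, ← add_sub_assoc, hW k hk, ← min_sub_sub_right]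
    congr 1
    · rw [actionValue_false]
      ring
    · rw [actionValue_true]
      ring
  rw [actionValue_true, actionValue_false] at hpas
  have hpas' : S.rate i * (V (s + 1) - V 1) ≤ c := by linarith
  rcases (S.rate_le_one i).lt_or_eq with hlt1 | heq1
  · have huniq := relativeValue_unique hlt1 (hD V hV) (hD _ hV') (by simp) (s + 1) (by omega)
    rw [huniq, thresholdValue_one hn, sub_zero] at hpas'
    exact (lt_mul_thresholdValue hm hn h2 hns).not_ge hpas'
  -- With sure service, strictness at the threshold reads `g' < n + 1 ≤ s + 1`, the hypothesis of
  -- `lt_of_bddBelow`.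
  · have h3 := thresholdCost_lt hm hn h2
    have h4 : (n : ℝ) ≤ s := by exact_mod_cast hns
    rw [← hgt, heq1, one_div_one] at h3
    refine (lt_of_bddBelow (c := c) (B := B - V 1) (g := g') (D := fun k => V k - V 1) (s := s)
      (by linarith) (fun k hk => sub_le_sub_right (hB k hk) _) fun k hk => ?_).not_ge
      (by simpa [heq1] using hpas')
    have := hD V hV k hk
    simpa [heq1] using this

end Network

end QSwitch

end

theorem theorem2 {N R : ℕ} (S : QSwitch.Network N R) (i : Fin R) (l : ℕ)
    (hl : (S.G i).card = l) (s : ℕ) (hs : 1 ≤ s) :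
    S.whittleIndex i s =
      (((s : ℝ) * (S.q l * S.v i * (s : ℝ) - S.q l * S.v i + 2) / (2 * (l : ℝ)) : ℝ) : EReal) := by
  subst hl
  have hcard : (0 : ℝ) < (S.G i).card := by exact_mod_cast (S.G_nonempty i).card_pos
  have hval : (s : ℝ) * (S.q (S.G i).card * S.v i * (s : ℝ) - S.q (S.G i).card * S.v i + 2) /
      (2 * ((S.G i).card : ℝ)) = QSwitch.criticalCost (S.rate i) s / (S.G i).card := by
    rw [QSwitch.criticalCost, QSwitch.Network.rate, div_div]
  rw [hval]
  have hnonneg : 0 ≤ QSwitch.criticalCost (S.rate i) s / (S.G i).card :=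
    div_nonneg ((Nat.cast_nonneg s).trans (QSwitch.le_criticalCost (S.rate_pos i) s)) hcard.le
  refine IsLeast.csInf_eq ⟨⟨_, ⟨hnonneg, ?_⟩, rfl⟩, ?_⟩
  · exact S.mem_passiveSet_criticalCost i hnonneg hs (div_mul_cancel₀ _ hcard.ne')
  · rintro _ ⟨τ, ⟨hτ, hmem⟩, rfl⟩
    exact EReal.coe_le_coe_iff.2
      ((div_le_iff₀ hcard).2 (S.criticalCost_le_of_mem_passiveSet i hτ hmem))
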